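/- Let $n\ge 2$. An \emph{$n$-web} is an oriented surface in $\mathbb R^3$ composed of finitely many embedded annuli, bands and discs. A band is an embedded square $[0,1]\times[0,1]$ with source $[0,1]\times\{0\}$ and target $[0,1]\times\{1\}$, and it is directed from its source to its target; annuli are directed as well. It is required that the annuli, the discs and the interiors $[0,1]\times(0,1)$ of the bands are pairwise disjoint; that the sources and targets of the bands are pairwise disjoint and lie in the boundaries of the discs; that the boundary of each disc contains either exactly $n$ sources and no targets (the disc is a \emph{source}) or exactly $n$ targets and no sources (the disc is a \emph{sink}); and that on the boundary of each disc one point outside the sources and targets of the bands is marked. The \emph{bracket} $\langle\Gamma\rangle_n\in\mathbb Z[q^{\pm 1/n}]$ of an $n$-web $\Gamma$ is the following isotopy invariant. Represent $\Gamma$ by a planar diagram without twists (the projection preserves the orientation of the surface) which is decomposed, from bottom to top, into elementary pieces, the marked point of each source being at the top of its disc with all bands leaving downwards, and the marked point of each sink being at the bottom of its disc with all bands entering from above. Let strands directed downwards carry a free module $V$ with basis $e_1,\dots,e_n$, strands directed upwards its dual $V^*$ with the dual basis $e^1,\dots,e^n$, and let $l(\sigma)$ be the number of inversions of $\sigma\in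 S_n$. Then $\langle\Gamma\rangle_n$ is the contraction of the following tensors: \begin{itemize} \item a positive crossing with both strands directed downwards gives $\hat R$, and a negative one gives $\hat R^{-1}$, where $\hat R(e_i\otimes e_j)$ is $q^{-1/n}e_j\otimes e_i$ if $i>j$, $q^{-1/n}q\,e_i\otimes e_i$ if $i=j$, and $q^{-1/n}\bigl(e_j\otimes e_i+(q-q^{-1})e_i\otimes e_j\bigr)$ if $i<j$; \item the caps give $V^*\otimes V\to\mathbb Z[q^{\pm1/n}]$, $e^i\otimes e_j\mapsto\delta_{ij}$, and $V\otimes V^*\to\mathbb Z[q^{\pm1/n}]$, $e_i\otimes e^j\mapsto q^{2i-n-1}\delta_{ij}$; \item the cups give $1\mapsto\sum_i e_i\otimes e^i$ and $1\mapsto\sum_i q^{n+1-2i}e^i\otimes e_i$; \item a sink gives $1\mapsto\sum_{\sigma\in S_n}(-q)^{l(\sigma)}e_{\sigma(1)}\otimes\dots\otimes e_{\sigma(n)}$; \item a source gives $V^{\otimes n}\to\mathbb Z[q^{\pm1/n}]$, $e_{i_1}\otimes\dots\otimes e_{i_n}\mapsto(-q)^{l(\sigma)}$ if $(i_1,\dots,i_n)=(\sigma(1),\dots,\sigma(n))$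 for some $\sigma\in S_n$, and $\mapsto 0$ otherwise. \end{itemize} \textbf{Proposition.} Let $\Gamma,\Gamma'$ be $n$-webs which differ only by the choice of the marked points on the boundaries of their discs. Then \begin{enumerate} \item[(i)] $\langle\Gamma\rangle_n=\langle\Gamma'\rangle_n$ if $n$ is odd; \item[(ii)] $\langle\Gamma\rangle_n\equiv\langle\Gamma'\rangle_n \pmod 2$ in $\mathbb Z[q^{\pm1/n}]$ if $n$ is even. \end{enumerate} The same holds, for every diagram (decomposed into elementary pieces) of the common underlying surface, for the contractions computed from that diagram with the two choices of marked points, after each disc has been turned in the plane so that its marked point comes to the prescribed position. -/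

import Mathlib

open scoped LaurentPolynomial

noncomputable section

namespace NWeb

/-! ## Webs in three-space -/

/-- Euclidean three-space, with coordinates `p 0 = x`, `p 1 = y`, `p 2 = z`. -/
abbrev Space := EuclideanSpace ℝ (Fin 3)

/-- The point `(x, y, z)`. -/
def pt (x y z : ℝ) : Space := !₂[x, y, z]

/-- The projection `(x, y, z) ↦ (x, y)` onto the plane, identified with `ℂ`. -/
def proj (p : Space) : ℂ := ⟨p 0, p 1⟩

/-- The square `[0,1] × [0,1]`, with points written `s + t i`. -/
def square : Set ℂ := {w | w.re ∈ Set.Icc (0 : ℝ) 1 ∧ w.im ∈ Set.Icc (0 : ℝ) 1}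

/-- What is left of the square without its source and target: `[0,1] × (0,1)`. -/
def squareInterior : Set ℂ := {w | w.re ∈ Set.Icc (0 : ℝ) 1 ∧ w.im ∈ Set.Ioo (0 : ℝ) 1}

/-- The strip `[0,1] × ℝ`, the universal cover of the annulus `[0,1] × ℝ/ℤ`. -/
def strip : Set ℂ := {w | w.re ∈ Set.Icc (0 : ℝ) 1}

/-- An `n`-web without its marked points: an oriented surface in three-space composed of finitely
many embedded annuli, bands and discs. Annuli, bands and discs are given as parametrized embeddings
of `[0,1] × ℝ/ℤ`, of the square and of the closed unit disc; only the values on these domains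
matter. Every piece is oriented by its parametrization, and the annuli and bands are directed by
their second coordinate. -/
structure Surface (n : ℕ) where
  numAnnuli : ℕ
  numBands : ℕ
  numDiscs : ℕ
  annulus : Fin numAnnuli → ℂ → Space
  band : Fin numBands → ℂ → Space
  disc : Fin numDiscs → ℂ → Space
  /-- the disc to which the source of a band is attached -/
  sourceDisc : Fin numBands → Fin numDiscs
  /-- the disc to which the target of a band is attached -/
  targetDisc : Fin numBands → Fin numDiscs
  annulus_periodic : ∀ a w, annulus a (w + Complex.I) = annulus a w
  annulus_continuous : ∀ a, ContinuousOn (annulus a) strip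
  annulus_injective : ∀ a, Set.InjOn (annulus a) {w ∈ strip | w.im ∈ Set.Ico (0 : ℝ) 1}
  band_continuous : ∀ b, ContinuousOn (band b) square
  band_injective : ∀ b, Set.InjOn (band b) square
  disc_continuous : ∀ v, ContinuousOn (disc v) (Metric.closedBall 0 1)
  disc_injective : ∀ v, Set.InjOn (disc v) (Metric.closedBall 0 1)
  /-- The annuli, the discs and the interiors of the bands are disjoint from each other. -/
  disjoint_pieces : Pairwise (Function.onFun Disjoint
    (Sum.elim (fun a => annulus a '' strip)
      (Sum.elim (fun b => band b '' squareInterior)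
        (fun v => disc v '' Metric.closedBall 0 1))))
  /-- The source of a band is an arc in the boundary of a disc. It runs clockwise, so that the
  orientations of the band and of the disc fit together. -/
  source_attached : ∀ b, ∃ α : ℝ → ℝ, ContinuousOn α (Set.Icc 0 1) ∧
    StrictAntiOn α (Set.Icc 0 1) ∧
    ∀ s ∈ Set.Icc (0 : ℝ) 1, band b s = disc (sourceDisc b) (Complex.exp (α s * Complex.I))
  /-- The target of a band is an arc in the boundary of a disc, and runs anticlockwise. -/
  target_attached : ∀ b, ∃ α : ℝ → ℝ, ContinuousOn α (Set.Icc 0 1) ∧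
    StrictMonoOn α (Set.Icc 0 1) ∧
    ∀ s ∈ Set.Icc (0 : ℝ) 1,
      band b (s + Complex.I) = disc (targetDisc b) (Complex.exp (α s * Complex.I))
  /-- The sources and the targets of the bands are disjoint from each other. -/
  disjoint_ends : Pairwise (Function.onFun Disjoint
    (Sum.elim (fun b => band b '' {w ∈ square | w.im = 0})
      (fun b => band b '' {w ∈ square | w.im = 1})))
  /-- Every disc is a source or a sink, and is `n`-valent. -/
  valence : ∀ v,
    (Nat.card {b // sourceDisc b = v} = n ∧ ∀ b, targetDisc b ≠ v) ∨
    (Nat.card {b // targetDisc b = v} = n ∧ ∀ b, sourceDisc b ≠ v)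

/-- A choice of marked points for a surface: one boundary point of each disc, outside the sources
and targets of the bands. -/
structure Marking {n : ℕ} (S : Surface n) where
  point : Fin S.numDiscs → Circle
  not_mem_ends : ∀ v b,
    S.disc v (point v) ∉ S.band b '' {w ∈ square | w.im = 0 ∨ w.im = 1}

/-- An `n`-web in three-space. -/
structure Web (n : ℕ) where
  surface : Surface n
  marking : Marking surface

/-- An ambient isotopy of three-space. -/
structure AmbientIsotopy where
  map : unitInterval → (Space ≃ₜ Space)
  continuous_map : Continuous fun x : unitInterval × Space => map x.1 x.2
  map_zero : map 0 = Homeomorph.refl Space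

/-- `f` is, near every point of the open set `U`, an orientation preserving embedding into the
plane: it is injective near `p`, and the image of a small circle around `p` winds once,
anticlockwise, around `f p`. -/
def PreservesOrientationOn (f : ℂ → ℂ) (U : Set ℂ) : Prop :=
  ∀ p ∈ U, ∃ r : ℝ, 0 < r ∧ Metric.closedBall p r ⊆ U ∧ Set.InjOn f (Metric.closedBall p r) ∧
    ∃ φ : ℝ → ℝ, Continuous φ ∧ (∀ θ, φ (θ + 2 * Real.pi) = φ θ + 2 * Real.pi) ∧
      ∀ θ : ℝ, f (p + r * Complex.exp (θ * Complex.I)) - f p =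
        ‖f (p + r * Complex.exp (θ * Complex.I)) - f p‖ * Complex.exp (φ θ * Complex.I)

/-! ## Diagrams decomposed into elementary pieces

Diagrams are read from the bottom to the top. A strand directed downwards carries the vector space
`V` with basis `e_1, …, e_n`, a strand directed upwards carries its dual. -/

/-- The direction of a strand. -/
inductive Dir
  | down
  | up

/-- The elementary pieces of a web diagram. -/
inductive Piece
  /-- both strands directed down, the strand from bottom left to top right on top -/
  | posCrossing
  /-- both strands directed down, the strand from bottom right to top left on top -/
  | negCrossing
  /-- a cap directed from left to right -/
  | capUpDown
  /-- a cap directed from right to left -/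
  | capDownUp
  /-- a cup directed from left to right -/
  | cupDownUp
  /-- a cup directed from right to left -/
  | cupUpDown
  /-- a source, all of its bands leave downwards -/
  | source
  /-- a sink, all of its bands come in from above -/
  | sink

/-- The strands at the bottom of a piece. -/
def Piece.dom (n : ℕ) : Piece → List Dir
  | posCrossing => [Dir.down, Dir.down]
  | negCrossing => [Dir.down, Dir.down]
  | capUpDown => [Dir.up, Dir.down]
  | capDownUp => [Dir.down, Dir.up]
  | cupDownUp => []
  | cupUpDown => []
  | source => List.replicate n Dir.down
  | sink => []

/-- The strands at the top of a piece. -/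
def Piece.cod (n : ℕ) : Piece → List Dir
  | posCrossing => [Dir.down, Dir.down]
  | negCrossing => [Dir.down, Dir.down]
  | capUpDown => []
  | capDownUp => []
  | cupDownUp => [Dir.down, Dir.up]
  | cupUpDown => [Dir.up, Dir.down]
  | source => []
  | sink => List.replicate n Dir.down

/-- The piece is a vertex of the web. -/
def Piece.IsVertex : Piece → Prop
  | source => True
  | sink => True
  | _ => False

/-- A horizontal layer of a diagram: one piece, with vertical strands to its left and right. -/
structure Layer where
  left : List Dir
  piece : Piece
  right : List Dir

/-- The strands at the bottom of a layer. -/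
def Layer.bottom (n : ℕ) (L : Layer) : List Dir := L.left ++ L.piece.dom n ++ L.right

/-- The strands at the top of a layer. -/
def Layer.top (n : ℕ) (L : Layer) : List Dir := L.left ++ L.piece.cod n ++ L.right

/-- The layers, listed from the bottom to the top, fit on top of each other; the strands at the
bottom are `a` and those at the top are `b`. -/
def IsTangle (n : ℕ) : List Dir → List Layer → List Dir → Prop
  | a, [], b => a = b
  | a, L :: W, b => a = L.bottom n ∧ IsTangle n (L.top n) W b

/-! ## Tensors -/

/-- The power `q ^ m` in `ℤ[q^{1/n}, q^{-1/n}]`; the variable of the Laurent polynomials is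
`q^{1/n}`. -/
def q (n : ℕ) (m : ℤ) : ℤ[T;T⁻¹] := LaurentPolynomial.T (n * m)

/-- The length of a permutation, as its number of inversions. -/
def permLength {n : ℕ} (σ : Equiv.Perm (Fin n)) : ℕ :=
  (Finset.univ.filter fun x : Fin n × Fin n => x.1 < x.2 ∧ σ x.2 < σ x.1).card

/-- `(-q) ^ l(σ)` if the labels form the permutation `σ`, and `0` if they form none. -/
def vertexCoeff {n : ℕ} (a : List (Fin n)) : ℤ[T;T⁻¹] :=
  ∑ σ : Equiv.Perm (Fin n), if a = List.ofFn σ then (-q n 1) ^ permLength σ else 0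

/-- The coefficient of `e_k ⊗ e_l` in `R (e_i ⊗ e_j)`. -/
def rCoeff {n : ℕ} (i j k l : Fin n) : ℤ[T;T⁻¹] :=
  LaurentPolynomial.T (-1) *
    (if i = j then (if k = i ∧ l = j then q n 1 else 0)
    else (if k = j ∧ l = i then 1 else 0) +
      (if i < j ∧ k = i ∧ l = j then q n 1 - q n (-1) else 0))

/-- The coefficient of `e_k ⊗ e_l` in `R⁻¹ (e_i ⊗ e_j)`. -/
def rInvCoeff {n : ℕ} (i j k l : Fin n) : ℤ[T;T⁻¹] :=
  LaurentPolynomial.T 1 *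
    (if i = j then (if k = i ∧ l = j then q n (-1) else 0)
    else (if k = j ∧ l = i then 1 else 0) -
      (if j < i ∧ k = i ∧ l = j then q n 1 - q n (-1) else 0))

/-- The matrix entries of the tensor of a piece, for the labels `a` at its bottom and `b` at its
top. The element `i` of `Fin n` is the label `i + 1`, so that `q^{2(i+1)-n-1} = q^{2i+1-n}`. -/
def Piece.coeff {n : ℕ} : Piece → List (Fin n) → List (Fin n) → ℤ[T;T⁻¹]
  | posCrossing, [i, j], [k, l] => rCoeff i j k l
  | negCrossing, [i, j], [k, l] => rInvCoeff i j k l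
  | capUpDown, [i, j], [] => if i = j then 1 else 0
  | capDownUp, [i, j], [] => if i = j then q n (2 * (i : ℤ) + 1 - n) else 0
  | cupDownUp, [], [i, j] => if i = j then 1 else 0
  | cupUpDown, [], [i, j] => if i = j then q n (n - 1 - 2 * (i : ℤ)) else 0
  | source, a, [] => vertexCoeff a
  | sink, [], b => vertexCoeff b
  | _, _, _ => 0

/-- The linear map of a layer, the tensor product of the tensor of the piece with identities. A
tensor is given by its coordinates, indexed by lists of labels. -/
def Layer.act {n : ℕ} (L : Layer) (v : List (Fin n) → ℤ[T;T⁻¹]) (b : List (Fin n)) : ℤ[T;T⁻¹] :=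
  ∑ a : Fin (L.piece.dom n).length → Fin n,
    L.piece.coeff (List.ofFn a) ((b.drop L.left.length).take (L.piece.cod n).length) *
      v (b.take L.left.length ++ List.ofFn a ++
        b.drop (L.left.length + (L.piece.cod n).length))

/-- The contraction of all the tensors of a closed diagram in which the marked point of every
source is at its top and the marked point of every sink is at its bottom. -/
def contraction (n : ℕ) (W : List Layer) : ℤ[T;T⁻¹] :=
  W.foldl (fun v L => Layer.act (n := n) L v) (fun b => if b = [] then 1 else 0) []

/-- `k` nested copies of the cup `cupDownUp`, the outermost at the bottom. -/
def cups (left right : List Dir) (k : ℕ) : List Layer :=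
  (List.range k).map fun j =>
    ⟨left ++ List.replicate j Dir.down, Piece.cupDownUp, List.replicate j Dir.up ++ right⟩

/-- `k` nested copies of the cap `capDownUp`, the outermost at the top. -/
def caps (left right : List Dir) (k : ℕ) : List Layer :=
  ((List.range k).map fun j =>
    (⟨left ++ List.replicate j Dir.down, Piece.capDownUp,
      List.replicate j Dir.up ++ right⟩ : Layer)).reverse

/-- Rotate the disc of a vertex whose marked point lies between its `k`-th and its `k+1`-st band
(the bands of a vertex are counted from left to right) in the plane, so that the marked point of a
source comes to the top and the marked point of a sink to the bottom. The first `k` bands then have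
to run around the disc: they reach the disc to the right of the other `n - k` bands, after passing
above a source, respectively below a sink. -/
def Layer.turn (n k : ℕ) (L : Layer) : List Layer :=
  match L.piece with
  | Piece.source =>
      cups (L.left ++ List.replicate n Dir.down) L.right k ++
      [⟨L.left ++ List.replicate k Dir.down, Piece.source, List.replicate k Dir.up ++ L.right⟩] ++
      caps L.left L.right k
  | Piece.sink =>
      cups L.left L.right k ++
      [⟨L.left ++ List.replicate k Dir.down, Piece.sink, List.replicate k Dir.up ++ L.right⟩] ++
      caps (L.left ++ List.replicate n Dir.down) L.right k
  | _ => [L]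

/-! ## The picture of a diagram

The layer number `j` occupies the heights `j ≤ y ≤ j + 1`, and at integer heights the strands are
at `x = 0, 1, 2, …`. -/

/-- The middle of the piece of a layer; for a vertex, the centre of its disc. -/
def Layer.center (n j : ℕ) (L : Layer) : Space :=
  match L.piece with
  | Piece.source => pt (L.left.length + ((n : ℝ) - 1) / 2) (j + 1 / 2) 0
  | Piece.sink => pt (L.left.length + ((n : ℝ) - 1) / 2) (j + 1 / 2) 0
  | _ => pt (L.left.length + 1 / 2) (j + 1 / 2) 0

/-- The union of the segments from the point `c` to the `m` points `(x + i, y, 0)`, `i < m`. -/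
def fan (c : Space) (x y : ℝ) (m : ℕ) : Set Space :=
  ⋃ i : Fin m, segment ℝ c (pt (x + (i : ℕ)) y 0)

/-- A strand from `(x, y, 0)` to `(x', y + 1, 0)` which passes over the plane. -/
def overStrand (x x' y : ℝ) : Set Space :=
  segment ℝ (pt x y 0) (pt ((x + x') / 2) (y + 1 / 2) 1) ∪
    segment ℝ (pt ((x + x') / 2) (y + 1 / 2) 1) (pt x' (y + 1) 0)

/-- The core of the piece of a layer. -/
def Layer.pieceCore (n j : ℕ) (L : Layer) : Set Space :=
  let x : ℝ := L.left.length
  match L.piece with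
  | Piece.posCrossing => overStrand x (x + 1) j ∪ segment ℝ (pt (x + 1) j 0) (pt x (j + 1) 0)
  | Piece.negCrossing => overStrand (x + 1) x j ∪ segment ℝ (pt x j 0) (pt (x + 1) (j + 1) 0)
  | _ => fan (L.center n j) x j (L.piece.dom n).length ∪
      fan (L.center n j) x (j + 1) (L.piece.cod n).length

/-- The core of a layer. -/
def Layer.core (n j : ℕ) (L : Layer) : Set Space :=
  (⋃ p : Fin L.left.length, segment ℝ (pt (p : ℕ) j 0) (pt (p : ℕ) (j + 1) 0)) ∪
  L.pieceCore n j ∪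
  ⋃ p : Fin L.right.length,
    segment ℝ (pt (L.left.length + (L.piece.dom n).length + (p : ℕ)) j 0)
      (pt (L.left.length + (L.piece.cod n).length + (p : ℕ)) (j + 1) 0)

/-- The vertices of a diagram. -/
abbrev Vertex (W : List Layer) := {j : Fin W.length // (W.get j).piece.IsVertex}

/-- The centre of the disc of a vertex. -/
def Vertex.center (n : ℕ) {W : List Layer} (c : Vertex W) : Space := (W.get c.1).center n c.1

/-- The radius of the discs in the picture of a diagram. -/
def discRadius (n : ℕ) : ℝ := 1 / (4 * (n + 1))

/-- The curve `γ` moves in the direction `d` when it leaves the point `γ t`. -/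
def Heads (d : Dir) (γ : ℝ → Space) (t : ℝ) : Prop :=
  match d with
  | Dir.down => ∀ᶠ u in nhdsWithin t (Set.Ioi t), γ u 1 < γ t 1
  | Dir.up => ∀ᶠ u in nhdsWithin t (Set.Ioi t), γ t 1 < γ u 1

/-- A diagram of a surface, decomposed into elementary pieces: an ambient isotopy which carries the
surface to a surface lying in three-space as described by a list of layers. The discs go to flat
round discs, and the projection to the plane is an orientation preserving local embedding (so that
the bands and annuli have no twists); the core lines of the bands and annuli go to the lines of the
picture, with crossings resolved by the third coordinate, and have the prescribed directions. -/
structure Diagram {n : ℕ} (S : Surface n) where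
  word : List Layer
  closed : IsTangle n [] word []
  isotopy : AmbientIsotopy
  vertex : Vertex word ≃ Fin S.numDiscs
  disc_flat : ∀ c : Vertex word,
    (fun w => isotopy.map 1 (S.disc (vertex c) w)) '' Metric.closedBall 0 1 =
      {p : Space | p 2 = 0 ∧ dist p (Vertex.center n c) ≤ discRadius n}
  disc_oriented : ∀ v,
    PreservesOrientationOn (fun w => proj (isotopy.map 1 (S.disc v w))) (Metric.ball 0 1)
  band_oriented : ∀ b,
    PreservesOrientationOn (fun w => proj (isotopy.map 1 (S.band b w))) (interior square)
  annulus_oriented : ∀ a,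
    PreservesOrientationOn (fun w => proj (isotopy.map 1 (S.annulus a w))) (interior strip)
  cores_eq :
    (⋃ b, (fun t : ℝ => isotopy.map 1 (S.band b (1 / 2 + t * Complex.I))) '' Set.Icc 0 1) ∪
      (⋃ a, Set.range fun t : ℝ => isotopy.map 1 (S.annulus a (1 / 2 + t * Complex.I))) =
    (⋃ j : Fin word.length, (word.get j).core n j) \
      ⋃ c : Vertex word, Metric.ball (Vertex.center n c) (discRadius n)
  band_direction : ∀ b, ∀ t ∈ Set.Ioo (0 : ℝ) 1, ∀ (j : Fin word.length)
    (p : Fin ((word.get j).bottom n).length),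
    isotopy.map 1 (S.band b (1 / 2 + t * Complex.I)) = pt (p : ℕ) (j : ℕ) 0 →
      Heads (((word.get j).bottom n).get p)
        (fun t : ℝ => isotopy.map 1 (S.band b (1 / 2 + t * Complex.I))) t
  annulus_direction : ∀ a, ∀ (t : ℝ) (j : Fin word.length)
    (p : Fin ((word.get j).bottom n).length),
    isotopy.map 1 (S.annulus a (1 / 2 + t * Complex.I)) = pt (p : ℕ) (j : ℕ) 0 →
      Heads (((word.get j).bottom n).get p)
        (fun t : ℝ => isotopy.map 1 (S.annulus a (1 / 2 + t * Complex.I))) t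

/-- The angle in `[0, 2π)` by which one has to turn anticlockwise from the direction `1` to the
direction `u`. -/
def sweep (u : ℂ) : ℝ := if 0 ≤ u.arg then u.arg else u.arg + 2 * Real.pi

/-- The number of bands of a source met on the way from the top of its disc anticlockwise to the
boundary point in the direction `u`. The `i`-th band leaves the disc in the direction
`(i - (n-1)/2, -1/2)`. -/
def bandsBefore (n : ℕ) (u : ℂ) : ℕ :=
  (Finset.univ.filter fun i : Fin n =>
    sweep ((⟨(i : ℕ) - ((n : ℝ) - 1) / 2, -(1 / 2)⟩ : ℂ) / Complex.I) <
      sweep (u / Complex.I)).card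

/-- The number of bands of a vertex lying to the left of its marked point: for a source, the bands
met on the way from the top of the disc anticlockwise to the marked point; for a sink, those met on
the way from the bottom of the disc clockwise to the marked point. It is `0` for layers which are
not vertices. -/
def Diagram.markPosition {n : ℕ} {S : Surface n} (P : Diagram S) (m : Marking S)
    (j : Fin P.word.length) : ℕ :=
  open Classical in
  if h : (P.word.get j).piece.IsVertex then
    let v := P.vertex ⟨j, h⟩
    let u : ℂ := proj (P.isotopy.map 1 (S.disc v (m.point v))) -
      proj (Vertex.center n (⟨j, h⟩ : Vertex P.word))
    match (P.word.get j).piece with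
    | Piece.sink => bandsBefore n (star u)
    | _ => bandsBefore n u
  else 0

/-- The bracket computed from a given diagram: turn the discs of all the vertices so that the
marked points come to their standard positions, and contract the tensors. -/
def Diagram.bracket {n : ℕ} {S : Surface n} (P : Diagram S) (m : Marking S) : ℤ[T;T⁻¹] :=
  contraction n
    ((List.finRange P.word.length).flatMap fun j => (P.word.get j).turn n (P.markPosition m j))

/-- The bracket of an `n`-web, in `ℤ[q^{1/n}, q^{-1/n}]`: the contraction of the tensors of a
diagram of the web. The bracket is an isotopy invariant, so the choice of the diagram is
immaterial. (A wildly embedded web without any diagram gets the value `0`.) -/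
def Web.bracket {n : ℕ} (Γ : Web n) : ℤ[T;T⁻¹] :=
  open Classical in
  if h : Nonempty (Diagram Γ.surface) then (Classical.choice h).bracket Γ.marking else 0

end NWeb

end

/-! Turning a disc changes the tensor of its vertex only by a sign. Count labels from 0. Moving the
leading label `x` of a permutation to the end loses the `x` inversions with smaller labels and gains
`n - 1 - x` with larger ones (`permLength_rotate`), so the coefficient is multiplied by
`(-q)^(n-1-2x)`. The band that has been led around the disc also passes a cap of weight
`q^(2x+1-n)`, which cancels the power of `q` and leaves `(-1)^(n-1)` (`vertexCoeff_rotate_one`). For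
`k` bands the sign is `(-1)^(k(n-1))` (`vertexCoeff_append_comm`).

Evaluating the nested cups and caps turns this into an identity of linear maps for one turned layer
(`exists_sign_actList_turn`). The signs are scalars, so they can be pulled out of the whole
contraction (`exists_sign_actList_flatMap`). Every marking therefore gives `(-1)^(e(n-1))` times one
contraction that does not depend on the marking. The sign is 1 for odd `n`, and any two signs agree
modulo 2. -/

namespace NWeb

/-! ### Sums over words of labels. -/

section Words

theorem exists_eq_append_of_length_eq_succ {α : Type*} {p : List α} {k : ℕ}
    (hp : p.length = k + 1) : ∃ p' i, p = p' ++ [i] := by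
  have h : p ≠ [] := by rintro rfl; simp at hp
  exact ⟨_, _, (List.dropLast_append_getLast h).symm⟩

variable {α R : Type*} [Fintype α] [CommRing R]

theorem sum_ofFn_add {N m k : ℕ} (h : N = m + k) (G : List α → R) :
    ∑ a : Fin N → α, G (List.ofFn a) =
      ∑ s : Fin m → α, ∑ t : Fin k → α, G (List.ofFn s ++ List.ofFn t) := by
  subst h
  rw [← Fintype.sum_prod_type', ← (Fin.appendEquiv m k).sum_comp]
  exact Finset.sum_congr rfl fun x _ => by
    rw [← List.ofFn_fin_append]; rfl

theorem sum_ofFn_succ {k : ℕ} (G : List α → R) :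
    ∑ a : Fin (k + 1) → α, G (List.ofFn a) =
      ∑ s : Fin k → α, ∑ i : α, G (List.ofFn s ++ [i]) := by
  rw [sum_ofFn_add rfl]
  refine Finset.sum_congr rfl fun s _ => ?_
  rw [← (Equiv.funUnique (Fin 1) α).sum_comp]
  exact Finset.sum_congr rfl fun t _ => by simp

theorem sum_ofFn_ite [DecidableEq α] {k : ℕ} (p : List α) (hp : p.length = k)
    (G : List α → R) :
    ∑ t : Fin k → α, (if p = List.ofFn t then G (List.ofFn t) else 0) = G p := by
  subst hp
  rw [Finset.sum_eq_single p.get]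
  · simp
  · intro t _ ht
    rw [if_neg]
    rintro h
    apply ht
    apply List.ofFn_injective
    rw [← h, List.ofFn_get]
  · simp

end Words

/-! ### Inversions and vertex coefficients under cyclic shifts. -/

section Permutations

theorem permLength_eq_sum {n : ℕ} (σ : Equiv.Perm (Fin n)) :
    permLength σ = ∑ i, ∑ j, if i < j ∧ σ j < σ i then 1 else 0 := by
  rw [permLength, Finset.card_filter, Fintype.sum_prod_type]

theorem sum_lt_perm {m : ℕ} (σ : Equiv.Perm (Fin (m + 1))) (x : Fin (m + 1)) :
    ∑ j, (if σ j < x then 1 else 0) = (x : ℕ) := by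
  rw [Equiv.sum_comp σ fun j => if j < x then 1 else 0, ← Finset.card_filter,
    Finset.filter_gt_eq_Iio, Fin.card_Iio]

theorem sum_gt_perm {m : ℕ} (σ : Equiv.Perm (Fin (m + 1))) (x : Fin (m + 1)) :
    ∑ j, (if x < σ j then 1 else 0) = m - (x : ℕ) := by
  rw [Equiv.sum_comp σ fun j => if x < j then 1 else 0, ← Finset.card_filter,
    Finset.filter_lt_eq_Ioi, Fin.card_Ioi, Nat.add_sub_cancel]

/-- Only inversions involving the value `σ 0` change: in first place it is inverted with the `σ 0`
smaller values, in last place with the `m - σ 0` larger ones. Adding terms on both sides avoids a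
signed difference. -/
theorem permLength_rotate {m : ℕ} (σ : Equiv.Perm (Fin (m + 1))) :
    permLength ((finRotate (m + 1)).trans σ) + (σ 0 : ℕ) =
      permLength σ + (m - (σ 0 : ℕ)) := by
  have h1 := sum_lt_perm σ (σ 0)
  have h2 := sum_gt_perm σ (σ 0)
  rw [Fin.sum_univ_succ] at h1 h2
  rw [permLength_eq_sum σ, Fin.sum_univ_succ]
  simp only [Fin.sum_univ_succ (n := m)]
  -- The value `σ 0` sits at index `0` for `σ` and at the last index after the shift; with these
  -- split off, the remaining double sums coincide.
  rw [permLength_eq_sum, Fin.sum_univ_castSucc]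
  simp only [Fin.sum_univ_castSucc (n := m)]
  simp only [Equiv.trans_apply, finRotate_apply, Fin.coeSucc_eq_succ,
    Fin.castSucc_lt_castSucc_iff, Fin.succ_lt_succ_iff, Fin.castSucc_lt_last, Fin.succ_pos,
    Fin.not_lt_zero, true_and, false_and, if_false, lt_irrefl,
    add_zero, zero_add, Finset.sum_add_distrib, Fin.last_add_one] at h1 h2 ⊢
  have h3 : ∀ i : Fin m, ¬ Fin.last m < i.castSucc := fun i => not_lt.2 (Fin.le_last _)
  simp only [h3, false_and, if_false, Finset.sum_const_zero, add_zero]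
  omega

theorem q_pow (n k : ℕ) (m : ℤ) : q n m ^ k = q n (k * m) := by
  rw [q, q, LaurentPolynomial.T_pow]; congr 1; ring

theorem q_mul (n : ℕ) (a b : ℤ) : q n a * q n b = q n (a + b) := by
  rw [q, q, q, ← LaurentPolynomial.T_add]; congr 1; ring

theorem vertexCoeff_rotate_one {n : ℕ} (x : Fin n) (a : List (Fin n))
    (ha : (x :: a).length = n) :
    vertexCoeff (a ++ [x]) * q n (2 * (x : ℤ) + 1 - n) =
      (-1) ^ (n - 1) * vertexCoeff (x :: a) := by
  obtain ⟨m, rfl⟩ : ∃ m, n = m + 1 := ⟨a.length, by simpa using ha.symm⟩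
  rw [vertexCoeff, vertexCoeff, Finset.sum_mul, Finset.mul_sum]
  -- Precomposing with the cyclic shift makes the two sums agree term by term.
  rw [← Equiv.sum_comp (Equiv.mulRight (finRotate (m + 1)))]
  refine Finset.sum_congr rfl fun σ _ => ?_
  have hσ : List.ofFn σ = σ 0 :: List.ofFn fun i : Fin m => σ i.succ := List.ofFn_succ
  have hr : List.ofFn (Equiv.mulRight (finRotate (m + 1)) σ) =
      (List.ofFn fun i : Fin m => σ i.succ) ++ [σ 0] := by
    rw [List.ofFn_succ', List.concat_eq_append]
    simp
  rw [hσ, hr]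
  by_cases h : x = σ 0 ∧ a = List.ofFn fun i : Fin m => σ i.succ
  · obtain ⟨rfl, rfl⟩ := h
    rw [if_pos rfl, if_pos rfl]
    have hl := permLength_rotate σ
    have hx : (σ 0 : ℕ) ≤ m := Nat.lt_succ_iff.1 (σ 0).2
    change (-q (m + 1) 1) ^ permLength ((finRotate (m + 1)).trans σ) * _ = _
    generalize permLength ((finRotate (m + 1)).trans σ) = A at *
    generalize permLength σ = B at *
    rw [neg_pow, neg_pow (q (m + 1) 1), q_pow, q_pow, mul_assoc, q_mul, ← mul_assoc, ← pow_add]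
    congr 1
    · rw [Nat.add_sub_cancel]
      -- The two lengths differ by `m` modulo 2, which gives the sign; the same equation matches the
      -- powers of `q`.
      have : A + 2 * (σ 0 : ℕ) = m + B := by omega
      rw [← this, pow_add, pow_mul]; simp
    · congr 1; push_cast; omega
  · rw [if_neg, if_neg]
    · simp
    · intro hc
      exact h (by simpa using hc)
    · intro hc
      have := List.append_inj' hc rfl
      exact h ⟨by simpa using this.2, this.1⟩

/-- The product of the weights of the caps with the given labels. -/
noncomputable def capWeight {n : ℕ} (p : List (Fin n)) : ℤ[T;T⁻¹] :=
  (p.map fun i : Fin n => q n (2 * (i : ℤ) + 1 - n)).prod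

/-- The labels of `p` are rotated one at a time; each contributes a factor `(-1)^(n-1)` and its own
cap weight. -/
theorem vertexCoeff_append_comm {n : ℕ} (p s : List (Fin n)) (h : (p ++ s).length = n) :
    vertexCoeff (s ++ p) * capWeight p = (-1) ^ (p.length * (n - 1)) * vertexCoeff (p ++ s) := by
  induction p generalizing s with
  | nil => simp [capWeight]
  | cons x p ih =>
    have h1 := ih (s ++ [x]) (by simp at h ⊢; omega)
    have h2 := vertexCoeff_rotate_one x (p ++ s) h
    rw [capWeight] at h1 ⊢
    rw [List.map_cons, List.prod_cons]
    rw [List.append_assoc, List.singleton_append, ← List.append_assoc] at h1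
    calc _ = (vertexCoeff (s ++ x :: p) *
          (p.map fun i : Fin n => q n (2 * (i : ℤ) + 1 - n)).prod) * q n (2 * (x : ℤ) + 1 - n) := by ring
      _ = _ := by
        rw [h1, mul_assoc, h2, List.cons_append, List.length_cons]
        ring

end Permutations

/-! ### Linear maps of layers, and turned vertices. -/

section Layers

variable {n : ℕ}

/-- The linear map of a list of layers. -/
noncomputable def actList (W : List Layer) (v : List (Fin n) → ℤ[T;T⁻¹]) :
    List (Fin n) → ℤ[T;T⁻¹] :=
  W.foldl (fun v L => Layer.act L v) v

theorem actList_append (W W' : List Layer) (v : List (Fin n) → ℤ[T;T⁻¹]) :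
    actList (W ++ W') v = actList W' (actList W v) := List.foldl_append

theorem actList_cons (L : Layer) (W : List Layer) (v : List (Fin n) → ℤ[T;T⁻¹]) :
    actList (L :: W) v = actList W (L.act v) := rfl

theorem actList_nil (v : List (Fin n) → ℤ[T;T⁻¹]) : actList [] v = v := rfl

/-- The free `N` allows the sum to be indexed by `Fin n`, `Fin 2` or `Fin 0` instead of by the
length of a list. -/
theorem act_append (L : Layer) (v : List (Fin n) → ℤ[T;T⁻¹]) (x c y : List (Fin n))
    (hx : x.length = L.left.length) (hc : c.length = (L.piece.cod n).length)
    {N : ℕ} (hN : (L.piece.dom n).length = N) :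
    L.act v (x ++ c ++ y) = ∑ a : Fin N → Fin n,
      L.piece.coeff (List.ofFn a) c * v (x ++ List.ofFn a ++ y) := by
  subst hN
  rw [Layer.act, ← hx, ← hc, ← List.length_append, List.drop_left, List.append_assoc,
    List.drop_left, List.take_left, List.take_left]

/-- Nesting pairs the outermost labels with each other, hence the reversal. The induction removes
the innermost cup, which is the last layer and has adjacent ends. -/
theorem actList_cups (l r : List Dir) (k : ℕ) (v : List (Fin n) → ℤ[T;T⁻¹])
    (x p p' y : List (Fin n)) (hx : x.length = l.length) (hp : p.length = k)
    (hp' : p'.length = k) :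
    actList (cups l r k) v (x ++ p ++ p'.reverse ++ y) = if p = p' then v (x ++ y) else 0 := by
  induction k generalizing p p' with
  | zero =>
    obtain rfl := List.length_eq_zero_iff.1 hp
    obtain rfl := List.length_eq_zero_iff.1 hp'
    simp [cups, actList_nil]
  | succ k ih =>
    obtain ⟨p, i, rfl⟩ := exists_eq_append_of_length_eq_succ hp
    obtain ⟨p', j, rfl⟩ := exists_eq_append_of_length_eq_succ hp'
    simp only [List.length_append, List.length_singleton, Nat.add_right_cancel_iff] at hp hp'
    rw [cups, List.range_succ, List.map_append, actList_append]
    simp only [List.map_singleton, actList_cons, actList_nil]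
    have e : x ++ (p ++ [i]) ++ (p' ++ [j]).reverse ++ y =
        (x ++ p) ++ [i, j] ++ (p'.reverse ++ y) := by simp
    rw [e, act_append _ _ _ _ _ (by simp [hx, hp]) (by simp [Piece.cod])
      (N := 0) rfl]
    have := ih p p' hp hp'
    rw [cups, List.append_assoc] at this
    simp only [Finset.univ_unique, Finset.sum_singleton, List.ofFn_zero, List.append_nil,
      Piece.coeff, this]
    by_cases h : i = j <;> simp [h]

theorem actList_caps (l r : List Dir) (k : ℕ) (v : List (Fin n) → ℤ[T;T⁻¹])
    (x y : List (Fin n)) (hx : x.length = l.length) :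
    actList (caps l r k) v (x ++ y) = ∑ p : Fin k → Fin n,
      capWeight (List.ofFn p) * v (x ++ List.ofFn p ++ (List.ofFn p).reverse ++ y) := by
  -- The innermost cap acts first, so it is absorbed into the tensor `v`.
  induction k generalizing v with
  | zero => simp [caps, actList_nil, capWeight]
  | succ k ih =>
    rw [caps, List.range_succ, List.map_append, List.reverse_append]
    simp only [List.map_singleton, List.reverse_singleton, List.singleton_append, actList_cons]
    rw [← caps, ih, sum_ofFn_succ
      (G := fun p => capWeight p * v (x ++ p ++ p.reverse ++ y))]
    refine Finset.sum_congr rfl fun p _ => ?_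
    have e : x ++ List.ofFn p ++ (List.ofFn p).reverse ++ y =
        (x ++ List.ofFn p) ++ [] ++ ((List.ofFn p).reverse ++ y) := by simp
    rw [e, act_append _ _ _ _ _ (by simp [hx]) (by simp [Piece.cod])
      (N := 2) rfl,
      sum_ofFn_add (m := 1) (k := 1) rfl (G := fun a => Piece.coeff Piece.capDownUp a [] *
      v ((x ++ List.ofFn p) ++ a ++ ((List.ofFn p).reverse ++ y))), Finset.mul_sum,
      ← (Equiv.funUnique (Fin 1) (Fin n)).symm.sum_comp]
    refine Finset.sum_congr rfl fun i _ => ?_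
    rw [← (Equiv.funUnique (Fin 1) (Fin n)).symm.sum_comp, Finset.sum_eq_single i]
    · simp [Piece.coeff, capWeight, mul_assoc]
    · intro j _ hj
      simp [Piece.coeff, hj.symm]
    · simp

theorem act_source (l r : List Dir) (v : List (Fin n) → ℤ[T;T⁻¹]) (x y : List (Fin n))
    (hx : x.length = l.length) :
    Layer.act ⟨l, Piece.source, r⟩ v (x ++ y) =
      ∑ a : Fin n → Fin n, vertexCoeff (List.ofFn a) * v (x ++ List.ofFn a ++ y) := by
  have := act_append ⟨l, Piece.source, r⟩ v x [] y hx rfl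
    (N := n) (by simp [Piece.dom])
  rw [List.append_nil] at this
  rw [this]
  rfl

theorem act_sink (l r : List Dir) (v : List (Fin n) → ℤ[T;T⁻¹]) (x c y : List (Fin n))
    (hx : x.length = l.length) (hc : c.length = n) :
    Layer.act ⟨l, Piece.sink, r⟩ v (x ++ c ++ y) = vertexCoeff c * v (x ++ y) := by
  rw [act_append ⟨l, Piece.sink, r⟩ v x c y hx (by simp [Piece.cod, hc]) (N := 0) rfl]
  simp only [Finset.univ_unique, Finset.sum_singleton, List.ofFn_zero, List.append_nil,
    Piece.coeff]

theorem actList_turn_source (l r : List Dir) {k : ℕ} (hk : k ≤ n)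
    (v : List (Fin n) → ℤ[T;T⁻¹]) (x y : List (Fin n)) (hx : x.length = l.length) :
    actList (Layer.turn n k ⟨l, Piece.source, r⟩) v (x ++ y) =
      (-1) ^ (k * (n - 1)) * Layer.act ⟨l, Piece.source, r⟩ v (x ++ y) := by
  rw [act_source l r v x y hx]
  simp only [Layer.turn, actList_append, actList_cons, actList_nil]
  rw [actList_caps _ _ _ _ _ _ hx, sum_ofFn_add (m := k) (k := n - k) (by omega)
    (G := fun a => vertexCoeff a * v (x ++ a ++ y)), Finset.mul_sum]
  refine Finset.sum_congr rfl fun p _ => ?_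
  rw [List.append_assoc, act_source _ _ _ _ _ (by simp [hx]),
    sum_ofFn_add (m := n - k) (k := k) (by omega)
    (G := fun a => vertexCoeff a * actList _ _ (x ++ List.ofFn p ++ a ++
      ((List.ofFn p).reverse ++ y))), Finset.mul_sum, Finset.mul_sum]
  refine Finset.sum_congr rfl fun s _ => ?_
  -- The cups force the last `k` labels at the disc to equal the labels `p` at the caps, so the sum
  -- over `t` collapses.
  have key : ∀ t : Fin k → Fin n,
      actList (cups (l ++ List.replicate n Dir.down) r k) v
        (x ++ List.ofFn p ++ (List.ofFn s ++ List.ofFn t) ++ ((List.ofFn p).reverse ++ y)) =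
      if List.ofFn p = List.ofFn t then v (x ++ (List.ofFn p ++ List.ofFn s) ++ y) else 0 := by
    intro t
    have := actList_cups (l ++ List.replicate n Dir.down) r k v
      (x ++ (List.ofFn p ++ List.ofFn s)) (List.ofFn t) (List.ofFn p) y
      (by simp [hx]; omega) (by simp) (by simp)
    simp only [eq_comm (a := List.ofFn t)] at this
    rw [← this]
    congr 1
    simp
  simp only [key, mul_ite, mul_zero]
  rw [sum_ofFn_ite (List.ofFn p) (by simp) (G := fun t => vertexCoeff (List.ofFn s ++ t) *
    v (x ++ (List.ofFn p ++ List.ofFn s) ++ y))]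
  have h := vertexCoeff_append_comm (List.ofFn p) (List.ofFn s) (by simp; omega)
  rw [List.length_ofFn] at h
  rw [← mul_assoc, ← mul_assoc, ← h]
  ring

theorem actList_turn_sink (l r : List Dir) {k : ℕ} (hk : k ≤ n)
    (v : List (Fin n) → ℤ[T;T⁻¹]) (x u y : List (Fin n)) (hx : x.length = l.length)
    (hu : u.length = n) :
    actList (Layer.turn n k ⟨l, Piece.sink, r⟩) v (x ++ u ++ y) =
      (-1) ^ (k * (n - 1)) * Layer.act ⟨l, Piece.sink, r⟩ v (x ++ u ++ y) := by
  rw [act_sink l r v x u y hx hu]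
  -- Here `p` labels the `k` bands that run around the disc.
  obtain ⟨p, s, rfl, hp⟩ : ∃ p s, u = p ++ s ∧ p.length = k :=
    ⟨u.take k, u.drop k, (List.take_append_drop k u).symm, by simp; omega⟩
  have hs : s.length = n - k := by simp at hu; omega
  simp only [Layer.turn, actList_append, actList_cons, actList_nil]
  rw [actList_caps _ _ _ _ _ _ (by simp [hx]; omega)]
  have key : ∀ t : Fin k → Fin n,
      Layer.act ⟨l ++ List.replicate k Dir.down, Piece.sink, List.replicate k Dir.up ++ r⟩
        (actList (cups l r k) v)
        (x ++ (p ++ s) ++ List.ofFn t ++ (List.ofFn t).reverse ++ y) =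
      if p = List.ofFn t then vertexCoeff (s ++ List.ofFn t) * v (x ++ y) else 0 := by
    intro t
    have e : x ++ (p ++ s) ++ List.ofFn t ++ (List.ofFn t).reverse ++ y =
      (x ++ p) ++ (s ++ List.ofFn t) ++ ((List.ofFn t).reverse ++ y) := by simp
    rw [e, act_sink _ _ _ _ _ _ (by simp [hx, hp]) (by simp; omega), ← List.append_assoc,
      actList_cups l r k v x p _ y hx hp (by simp), mul_ite, mul_zero]
  simp only [key, mul_ite, mul_zero]
  rw [sum_ofFn_ite p hp (G := fun t => capWeight t * (vertexCoeff (s ++ t) * v (x ++ y)))]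
  have h := vertexCoeff_append_comm p s hu
  rw [hp] at h
  rw [← mul_assoc, ← mul_assoc, ← h]
  ring

/-- Turning the disc of a vertex multiplies its tensor by a sign. -/
theorem exists_sign_actList_turn (L : Layer) {k : ℕ} (hk : k ≤ n) :
    ∃ m : ℕ, ∀ (v : List (Fin n) → ℤ[T;T⁻¹]) (b : List (Fin n)),
      b.length = (L.top n).length →
        actList (L.turn n k) v b = (-1) ^ (m * (n - 1)) * L.act v b := by
  obtain ⟨l, P, r⟩ := L
  have trivial_turn : Layer.turn n k ⟨l, P, r⟩ = [⟨l, P, r⟩] → ∃ m : ℕ,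
      ∀ (v : List (Fin n) → ℤ[T;T⁻¹]) (b : List (Fin n)),
      b.length = (Layer.top n ⟨l, P, r⟩).length →
        actList (Layer.turn n k ⟨l, P, r⟩) v b =
          (-1) ^ (m * (n - 1)) * Layer.act ⟨l, P, r⟩ v b := by
    intro h
    exact ⟨0, fun v b _ => by simp [h, actList_cons, actList_nil]⟩
  cases P
  case source =>
    refine ⟨k, fun v b hb => ?_⟩
    rw [← List.take_append_drop l.length b]
    refine actList_turn_source l r hk v _ _ ?_
    simp [Layer.top] at hb
    simp; omega
  case sink =>
    refine ⟨k, fun v b hb => ?_⟩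
    simp [Layer.top, Piece.cod] at hb
    rw [← List.take_append_drop l.length b, ← List.take_append_drop n (b.drop l.length),
      ← List.append_assoc]
    refine actList_turn_sink l r hk v _ _ _ ?_ ?_ <;> simp <;> omega
  all_goals exact trivial_turn rfl

/-- Tensors are functions on words of all lengths, but only words of the length of the boundary are
meaningful. The sign identities hold just there, which suffices to pass them through a layer. -/
theorem act_const_mul_congr (L : Layer) (c : ℤ[T;T⁻¹]) (v w : List (Fin n) → ℤ[T;T⁻¹])
    (h : ∀ a : List (Fin n), a.length = (L.bottom n).length → v a = c * w a)
    (b : List (Fin n)) (hb : b.length = (L.top n).length) : L.act v b = c * L.act w b := by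
  simp only [Layer.top, List.length_append] at hb
  rw [Layer.act, Layer.act, Finset.mul_sum]
  refine Finset.sum_congr rfl fun a _ => ?_
  rw [h _ (by simp [Layer.bottom]; omega)]
  ring

theorem exists_sign_actList_flatMap {ι : Type*} (f : ι → Layer) (k : ι → ℕ)
    (hk : ∀ j, k j ≤ n) (J : List ι) (a b : List Dir) (hJ : IsTangle n a (J.map f) b) :
    ∃ m : ℕ, ∀ v w : List (Fin n) → ℤ[T;T⁻¹], ∀ c : ℤ[T;T⁻¹],
      (∀ s : List (Fin n), s.length = a.length → v s = c * w s) →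
      ∀ s : List (Fin n), s.length = b.length →
        actList (J.flatMap fun j => (f j).turn n (k j)) v s =
          (-1) ^ (m * (n - 1)) * c * actList (J.map f) w s := by
  induction J generalizing a with
  | nil =>
    obtain rfl : a = b := hJ
    exact ⟨0, fun v w c h s hs => by simpa [actList_nil] using h s hs⟩
  | cons j J ih =>
    obtain ⟨rfl, hJ⟩ := hJ
    obtain ⟨m, hm⟩ := ih _ hJ
    obtain ⟨m', hm'⟩ := exists_sign_actList_turn (f j) (hk j)
    refine ⟨m + m', fun v w c h s hs => ?_⟩
    rw [List.flatMap_cons, List.map_cons, actList_append, actList_cons,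
      -- The scalar handed to the inductive hypothesis carries the sign of the first layer.
      hm _ _ ((-1) ^ (m' * (n - 1)) * c) (fun t ht => ?_) s hs]
    · ring
    · rw [hm' v t ht, act_const_mul_congr (f j) c v w h t ht, mul_assoc]

end Layers

/-! ### Brackets of diagrams and of webs. -/

theorem bandsBefore_le (n : ℕ) (u : ℂ) : bandsBefore n u ≤ n :=
  (Finset.card_le_univ _).trans (Fintype.card_fin n).le

/-- This bound is all the geometry of the marked points that the argument needs: at most `n` bands
are led around a disc. -/
theorem Diagram.markPosition_le {n : ℕ} {S : Surface n} (P : Diagram S) (m : Marking S)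
    (j : Fin P.word.length) : P.markPosition m j ≤ n := by
  unfold Diagram.markPosition
  split_ifs
  · dsimp only
    split <;> exact bandsBefore_le _ _
  · exact Nat.zero_le n

/-- Up to a sign, the bracket is the contraction of the diagram with the standard marked points. -/
theorem Diagram.exists_sign_bracket {n : ℕ} {S : Surface n} (P : Diagram S) (m : Marking S) :
    ∃ e : ℕ, P.bracket m = (-1) ^ (e * (n - 1)) * contraction n P.word := by
  have hw : (List.finRange P.word.length).map P.word.get = P.word := List.map_get_finRange _
  obtain ⟨e, he⟩ := exists_sign_actList_flatMap (n := n) P.word.get (P.markPosition m)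
    (P.markPosition_le m) (List.finRange P.word.length) [] [] (by rw [hw]; exact P.closed)
  refine ⟨e, ?_⟩
  have := he (fun b => if b = [] then 1 else 0) _ 1 (fun s _ => (one_mul _).symm) [] rfl
  rwa [hw, mul_one] at this

theorem Diagram.bracket_eq_of_odd {n : ℕ} (hn : Odd n) {S : Surface n} (P : Diagram S)
    (m m' : Marking S) : P.bracket m = P.bracket m' := by
  obtain ⟨e, he⟩ := P.exists_sign_bracket m
  obtain ⟨e', he'⟩ := P.exists_sign_bracket m'
  have h : Even (n - 1) := hn.tsub_odd odd_one
  rw [he, he', (h.mul_left e).neg_one_pow, (h.mul_left e').neg_one_pow]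

theorem Diagram.two_dvd_bracket_sub {n : ℕ} {S : Surface n} (P : Diagram S)
    (m m' : Marking S) : (2 : ℤ[T;T⁻¹]) ∣ P.bracket m - P.bracket m' := by
  obtain ⟨e, he⟩ := P.exists_sign_bracket m
  obtain ⟨e', he'⟩ := P.exists_sign_bracket m'
  rw [he, he', ← sub_mul]
  refine Dvd.dvd.mul_right ?_ _
  rcases neg_one_pow_eq_or ℤ[T;T⁻¹] (e * (n - 1)) with h | h <;>
  rcases neg_one_pow_eq_or ℤ[T;T⁻¹] (e' * (n - 1)) with h' | h' <;> rw [h, h']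
  · simp
  · exact ⟨1, by ring⟩
  · exact ⟨-1, by ring⟩
  · simp

end NWeb

theorem mainTheorem5 (n : ℕ) (hn : 2 ≤ n) (S : NWeb.Surface n) (m m' : NWeb.Marking S) :
    (Odd n →
      (NWeb.Web.mk S m).bracket = (NWeb.Web.mk S m').bracket ∧
      ∀ P : NWeb.Diagram S, P.bracket m = P.bracket m') ∧
    (Even n →
      (2 : ℤ[T;T⁻¹]) ∣ (NWeb.Web.mk S m).bracket - (NWeb.Web.mk S m').bracket ∧
      ∀ P : NWeb.Diagram S, (2 : ℤ[T;T⁻¹]) ∣ P.bracket m - P.bracket m') := by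
  refine ⟨fun h => ⟨?_, fun P => P.bracket_eq_of_odd h m m'⟩,
    fun _ => ⟨?_, fun P => P.two_dvd_bracket_sub m m'⟩⟩
  -- Diagrams belong to the surface alone, so both webs are evaluated on the same chosen diagram and
  -- isotopy invariance plays no role. Without a diagram both brackets are the default value `0`.
  · by_cases hD : Nonempty (NWeb.Diagram S)
    · simpa [NWeb.Web.bracket, hD] using (Classical.choice hD).bracket_eq_of_odd h m m'
    · simp [NWeb.Web.bracket, hD]
  · by_cases hD : Nonempty (NWeb.Diagram S)
    · simpa [NWeb.Web.bracket, hD] using (Classical.choice hD).two_dvd_bracket_sub m m'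
    · simp [NWeb.Web.bracket, hD]
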